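/- Let $G$ be a finite simple graph on $n$ vertices (no connectivity is assumed), and let $C$ be a longest cycle in $G$, of length $c$, where $4\le c\le n-1$. If the number of edges of $G$ with at most one endpoint in $V(C)$ is greater than $\left(\lfloor c/2\rfloor-1\right)(n-c)$, then at least one of the following holds: (a) $c\in\{6,7,9\}$; (b) there is a vertex $u\in V(G)\setminus V(C)$ that has exactly $\lfloor c/2\rfloor$ neighbors in $V(C)$; (c) there is a cycle $C'$ in $G$ with $|V(C)\cap V(C')|\le 1$ such that $|V(C')|\ge 2\lfloor c/2\rfloor-3$ if $V(C)\cap V(C')=\emptyset$, and $|V(C')|\ge 2\lfloor c/2\rfloor-1$ if $|V(C)\cap V(C')|=1$. -/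

import Mathlib

namespace LongestCycle

/-- A closed walk `C` of `G` is a longest cycle of `G`: it is a cycle, and no cycle of `G` is
longer. -/
def IsLongestCycle {V : Type*} (G : SimpleGraph V) {v : V} (C : G.Walk v v) : Prop :=
  C.IsCycle ∧ ∀ (w : V) (D : G.Walk w w), D.IsCycle → D.length ≤ C.length

/-- The set of edges of `G` that have at most one endpoint in `S`. -/
def edgesAtMostOneEnd {V : Type*} (G : SimpleGraph V) (S : Set V) : Set (Sym2 V) :=
  {e | e ∈ G.edgeSet ∧ {x : V | x ∈ e ∧ x ∈ S}.ncard ≤ 1}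

/-- The set of vertices of a walk. -/
def vertexSet {V : Type*} {G : SimpleGraph V} {u v : V} (C : G.Walk u v) : Set V :=
  {x | x ∈ C.support}

end LongestCycle

/-!
Let `k = c / 2` and let `K` be the vertex set of the longest cycle `C`. If (a), (b) and (c) all
fail, every nonempty set `R` of vertices off `K` contains a nonempty set `S` that meets at most
`(k - 1) |S|` edges of `G[R ∪ K]` (`IsCyclicEnum.exists_sparse`). Removing such sets one after the
other from the complement of `K` bounds the number of edges with at most one end in `K` by
`(k - 1) (n - c)` (`card_pairs_le`). In place of edges, ordered pairs are counted: `S` is sparse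
when every `u ∈ S` has degree plus number of neighbours outside `S` at most `2 (k - 1)`.

To find `S`, assume that all degrees in `G[R ∪ K]` of vertices of `R` are at least `k`, since
otherwise one vertex will do. Take a longest path of `R` whose last vertex has a neighbour `w`
in `K`.

* If every longest such path towards `w` starts at a vertex with no neighbour in `K` other than `w`,
  then by the failure of (c) these paths live in a graph `R ∪ {w}` without cycles of length
  `2 k - 1` or more. Choose one whose first vertex has maximum degree `d`. The rotations of
  the path have `d` first vertices, which form `S`. They have degree at most `d`, and all of their
  neighbours are among the first `2 k - 2` vertices, so at most `2 k - 2 - d` of these are outside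
  `S` (`exists_sparse_of_rotation`). The same works with a root in `R` if `R` has no neighbours
  in `K`.
* Otherwise some longest path, of length `ℓ`, has neighbour sets `A`, `B` of its ends in `K`,
  with members `a ∈ A` and `b ∈ B`, `a ≠ b`. As `C` is longest, `2 |A ∪ B| + 2 ℓ ≤ c`, while
  `|A|` and `|B|` are at least `k - ℓ`. So `A = B` has exactly `k - ℓ` members, and these are at
  mutual distance at least `ℓ + 2` on `C`, which gives `(|A| - 2) ℓ ≤ 1`. Since (a) and (b) fail,
  `|A| = 2` and `k ≥ 4`. Rotations show that all vertices of the path have two neighbours in `K`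
  and no neighbours elsewhere off the path, and the `k - 1` vertices of the path form `S`
  (`IsCyclicEnum.exists_sparse_of_attached`).
-/

namespace LongestCycle

variable {V : Type*} {G : SimpleGraph V}

/-! ### Paths and cycles as vertex sequences -/

/-- The values `p 0, …, p ℓ` are the successive vertices of a path of length `ℓ` in `G`; the values
of `p` beyond `ℓ` are irrelevant. -/
structure IsPathSeq (G : SimpleGraph V) (p : ℕ → V) (ℓ : ℕ) : Prop where
  inj : ∀ i ≤ ℓ, ∀ j ≤ ℓ, p i = p j → i = j
  adj : ∀ i < ℓ, G.Adj (p i) (p (i + 1))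

/-- The values `g 0, …, g (m - 1)` are the successive vertices of a cycle of length `m` in `G`; the
values of `g` from `m` on are irrelevant. -/
structure IsCycleSeq (G : SimpleGraph V) (g : ℕ → V) (m : ℕ) : Prop where
  three_le : 3 ≤ m
  path : IsPathSeq G g (m - 1)
  close : G.Adj (g (m - 1)) (g 0)

theorem IsPathSeq.single (u : V) : IsPathSeq G (fun _ => u) 0 :=
  ⟨fun i hi j hj _ => by omega, fun i hi => by omega⟩

theorem IsPathSeq.mono {p : ℕ → V} {ℓ j : ℕ} (hp : IsPathSeq G p ℓ) (hj : j ≤ ℓ) :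
    IsPathSeq G p j :=
  ⟨fun a ha b hb => hp.inj a (ha.trans hj) b (hb.trans hj), fun a ha => hp.adj a (by omega)⟩

theorem IsPathSeq.reverse {p : ℕ → V} {ℓ : ℕ} (hp : IsPathSeq G p ℓ) :
    IsPathSeq G (fun i => p (ℓ - i)) ℓ := by
  refine ⟨fun i hi j hj h => ?_, fun i hi => ?_⟩
  · have := hp.inj _ (by omega) _ (by omega) h
    omega
  · have := hp.adj (ℓ - (i + 1)) (by omega)
    rw [show ℓ - (i + 1) + 1 = ℓ - i by omega] at this
    exact this.symm

/-- The sequence `p` with its initial segment `p 0, …, p i` reversed. If `p 0` is adjacent to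
`p (i + 1)`, this is Pósa's rotation of the path. -/
def rotation (p : ℕ → V) (i : ℕ) : ℕ → V := fun j => if j ≤ i then p (i - j) else p j

theorem rotation_zero (p : ℕ → V) (i : ℕ) : rotation p i 0 = p i := by simp [rotation]

theorem rotation_of_lt (p : ℕ → V) {i j : ℕ} (h : i < j) : rotation p i j = p j := by
  simp [rotation, not_le.2 h]

theorem rotation_eq (p : ℕ → V) {i m j : ℕ} (hi : i ≤ m) (hj : j ≤ m) :
    ∃ a ≤ m, rotation p i j = p a := by
  unfold rotation
  split_ifs
  exacts [⟨i - j, by omega, rfl⟩, ⟨j, hj, rfl⟩]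

theorem IsPathSeq.rotation {p : ℕ → V} {ℓ i : ℕ} (hp : IsPathSeq G p ℓ) (hi : i < ℓ)
    (h : G.Adj (p 0) (p (i + 1))) : IsPathSeq G (rotation p i) ℓ := by
  refine ⟨fun a ha b hb hab => ?_, fun a ha => ?_⟩
  · unfold LongestCycle.rotation at hab
    split_ifs at hab <;> have := hp.inj _ (by omega) _ (by omega) hab <;> omega
  · unfold LongestCycle.rotation
    split_ifs with h1 h2 h2
    · have := hp.adj (i - (a + 1)) (by omega)
      rw [show i - (a + 1) + 1 = i - a by omega] at this
      exact this.symm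
    · obtain rfl : a = i := by omega
      simpa using h
    · omega
    · exact hp.adj a ha

theorem IsPathSeq.cons {p : ℕ → V} {ℓ : ℕ} {u : V} (hp : IsPathSeq G p ℓ) (h : G.Adj u (p 0))
    (hu : ∀ i ≤ ℓ, p i ≠ u) : IsPathSeq G (fun i => if i = 0 then u else p (i - 1)) (ℓ + 1) := by
  refine ⟨fun a ha b hb hab => ?_, fun a ha => ?_⟩
  · split_ifs at hab with h1 h2 h2
    · omega
    · exact absurd hab.symm (hu _ (by omega))
    · exact absurd hab (hu _ (by omega))
    · have := hp.inj _ (by omega) _ (by omega) hab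
      omega
  · rcases Nat.eq_zero_or_pos a with rfl | ha0
    · simpa using h
    · have := hp.adj (a - 1) (by omega)
      rw [show a - 1 + 1 = a by omega] at this
      simpa [ha0.ne'] using this

/-- A chord from the first vertex of a path closes a cycle. -/
theorem IsPathSeq.isCycleSeq {p : ℕ → V} {ℓ j : ℕ} (hp : IsPathSeq G p ℓ) (h2 : 2 ≤ j)
    (hj : j ≤ ℓ) (h : G.Adj (p 0) (p j)) : IsCycleSeq G p (j + 1) :=
  ⟨by omega, by simpa using hp.mono hj, by simpa using h.symm⟩

theorem IsPathSeq.length_lt_card [Fintype V] {p : ℕ → V} {ℓ : ℕ} (hp : IsPathSeq G p ℓ) :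
    ℓ < Fintype.card V := by
  have h := Finset.card_le_card_of_injOn (s := Finset.range (ℓ + 1)) (t := Finset.univ) p
    (fun _ _ => Finset.mem_univ _) (fun a ha b hb hab => by
      simp only [Finset.coe_range, Set.mem_Iio] at ha hb
      exact hp.inj a (by omega) b (by omega) hab)
  simpa [Finset.card_univ] using h

theorem IsPathSeq.exists_walk {p : ℕ → V} {ℓ : ℕ} (hp : IsPathSeq G p ℓ) :
    ∃ w : G.Walk (p 0) (p ℓ), w.IsPath ∧ w.length = ℓ ∧
      (∀ x ∈ w.support, ∃ i ≤ ℓ, p i = x) ∧ ∀ e ∈ w.edges, ∃ i < ℓ, e = s(p i, p (i + 1)) := by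
  induction ℓ with
  | zero => exact ⟨.nil, by simp, by simp, by simp, by simp⟩
  | succ ℓ ih =>
    obtain ⟨w, hw, hl, hs, he⟩ := ih (hp.mono (Nat.le_succ ℓ))
    refine ⟨w.concat (hp.adj ℓ (by omega)), hw.concat (fun hmem => ?_) _, by simp [hl], ?_, ?_⟩
    · obtain ⟨i, hi, h⟩ := hs _ hmem
      have := hp.inj i (by omega) (ℓ + 1) le_rfl h
      omega
    · intro x hx
      rw [SimpleGraph.Walk.support_concat, List.mem_append] at hx
      rcases hx with hx | hx
      · obtain ⟨i, hi, h⟩ := hs x hx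
        exact ⟨i, by omega, h⟩
      · exact ⟨ℓ + 1, le_rfl, (List.mem_singleton.1 hx).symm⟩
    · intro e hx
      rw [SimpleGraph.Walk.edges_concat, List.concat_eq_append, List.mem_append] at hx
      rcases hx with hx | hx
      · obtain ⟨i, hi, h⟩ := he e hx
        exact ⟨i, by omega, h⟩
      · exact ⟨ℓ, by omega, by simpa using hx⟩

theorem IsCycleSeq.exists_walk {g : ℕ → V} {m : ℕ} (hg : IsCycleSeq G g m) :
    ∃ (v : V) (D : G.Walk v v), D.IsCycle ∧ D.length = m ∧ ∀ x ∈ D.support, ∃ i < m, g i = x := by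
  have h3 := hg.three_le
  obtain ⟨w, hw, hl, hs, he⟩ := hg.path.exists_walk
  refine ⟨_, w.cons hg.close, (SimpleGraph.Walk.cons_isCycle_iff _ _).2 ⟨hw, fun hmem => ?_⟩,
    by rw [SimpleGraph.Walk.length_cons, hl]; omega, fun x hx => ?_⟩
  · obtain ⟨i, hi, h⟩ := he _ hmem
    rcases Sym2.eq_iff.1 h with ⟨h1, h2⟩ | ⟨h1, h2⟩
    · have := hg.path.inj _ (by omega) _ (by omega) h1
      omega
    · have := hg.path.inj _ (by omega) _ (by omega) h1
      have := hg.path.inj _ (by omega) _ (by omega) h2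
      omega
  · rw [SimpleGraph.Walk.support_cons, List.mem_cons] at hx
    rcases hx with rfl | hx
    · exact ⟨m - 1, by omega, rfl⟩
    · obtain ⟨i, hi, h⟩ := hs x hx
      exact ⟨i, by omega, h⟩

/-- A maximum exists for a natural-number invariant that is bounded on the objects considered. -/
theorem exists_maximal_nat {α : Type*} (P : α → Prop) (f : α → ℕ) (b : ℕ)
    (hb : ∀ x, P x → f x ≤ b) (hne : ∃ x, P x) : ∃ x, P x ∧ ∀ y, P y → f y ≤ f x := by
  have hfin : (f '' {x | P x}).Finite :=
    (Set.finite_Iic b).subset (by rintro _ ⟨x, hx, rfl⟩; exact hb x hx)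
  obtain ⟨x0, hx0⟩ := hne
  obtain ⟨x, hx, hmax⟩ := Set.exists_max_image (f '' {x | P x}) id hfin ⟨_, x0, hx0, rfl⟩
  obtain ⟨y, hy, rfl⟩ := hx
  exact ⟨y, hy, fun z hz => hmax _ ⟨z, hz, rfl⟩⟩

/-! ### Counting edges by degrees, and positions on a cycle -/

open Classical in
/-- The neighbours of `u` in the finite set `X`. -/
noncomputable def nbrsIn (G : SimpleGraph V) (X : Finset V) (u : V) : Finset V :=
  X.filter (G.Adj u)

theorem mem_nbrsIn {X : Finset V} {u v : V} : v ∈ nbrsIn G X u ↔ v ∈ X ∧ G.Adj u v := by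
  simp [nbrsIn]

open Classical in
/-- The ordered pairs of adjacent vertices of `R ∪ K` that have at least one member in `R`. -/
noncomputable def pairs [Fintype V] (G : SimpleGraph V) (K R : Finset V) : Finset (V × V) :=
  Finset.univ.filter fun a =>
    G.Adj a.1 a.2 ∧ a.1 ∈ R ∪ K ∧ a.2 ∈ R ∪ K ∧ (a.1 ∈ R ∨ a.2 ∈ R)

open Classical in
theorem card_pairs_le_add [Fintype V] {K R S : Finset V} (m : ℕ)
    (h : ∀ u ∈ S, (nbrsIn G (R ∪ K) u).card + (nbrsIn G (R ∪ K) u \ S).card ≤ m) :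
    (pairs G K R).card ≤ (pairs G K (R \ S)).card + m * S.card := by
  -- Pairs that meet `S`: those with first member in `S`, and those with only the second one there.
  let A := S.sigma fun u => nbrsIn G (R ∪ K) u
  let B := S.sigma fun u => nbrsIn G (R ∪ K) u \ S
  have hsub : pairs G K R ⊆ pairs G K (R \ S) ∪ (A.image (fun a => (a.1, a.2)) ∪
      B.image (fun a => (a.2, a.1))) := by
    rintro ⟨x, y⟩ hxy
    simp only [pairs, Finset.mem_filter, Finset.mem_univ, true_and] at hxy
    obtain ⟨hadj, hx, hy, hR⟩ := hxy
    by_cases hxS : x ∈ S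
    · refine Finset.mem_union_right _ (Finset.mem_union_left _
        (Finset.mem_image.2 ⟨⟨x, y⟩, ?_, rfl⟩))
      exact Finset.mem_sigma.2 ⟨hxS, mem_nbrsIn.2 ⟨hy, hadj⟩⟩
    by_cases hyS : y ∈ S
    · refine Finset.mem_union_right _ (Finset.mem_union_right _
        (Finset.mem_image.2 ⟨⟨y, x⟩, ?_, rfl⟩))
      exact Finset.mem_sigma.2 ⟨hyS, Finset.mem_sdiff.2 ⟨mem_nbrsIn.2 ⟨hx, hadj.symm⟩, hxS⟩⟩
    · refine Finset.mem_union_left _ ?_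
      simp only [pairs, Finset.mem_filter, Finset.mem_univ, true_and, Finset.mem_union,
        Finset.mem_sdiff] at hx hy ⊢
      tauto
  calc (pairs G K R).card
      ≤ (pairs G K (R \ S)).card + ((A.image (fun a => (a.1, a.2))).card +
          (B.image (fun a => (a.2, a.1))).card) :=
        (Finset.card_le_card hsub).trans ((Finset.card_union_le _ _).trans
          (Nat.add_le_add_left (Finset.card_union_le _ _) _))
    _ ≤ (pairs G K (R \ S)).card + (A.card + B.card) :=
        Nat.add_le_add_left (Nat.add_le_add Finset.card_image_le Finset.card_image_le) _
    _ ≤ (pairs G K (R \ S)).card + m * S.card := by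
        refine Nat.add_le_add_left ?_ _
        rw [Finset.card_sigma, Finset.card_sigma, ← Finset.sum_add_distrib]
        refine (Finset.sum_le_sum h).trans ?_
        rw [Finset.sum_const, smul_eq_mul, mul_comm]

open Classical in
/-- If sets that meet few adjacent pairs can be removed one after the other until nothing is left,
there are few pairs. -/
theorem card_pairs_le [Fintype V] {K : Finset V} (m : ℕ)
    (h : ∀ R : Finset V, Disjoint R K → R.Nonempty → ∃ S ⊆ R, S.Nonempty ∧
      ∀ u ∈ S, (nbrsIn G (R ∪ K) u).card + (nbrsIn G (R ∪ K) u \ S).card ≤ m)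
    (R : Finset V) (hR : Disjoint R K) : (pairs G K R).card ≤ m * R.card := by
  induction R using Finset.strongInduction with
  | H R ih =>
    rcases R.eq_empty_or_nonempty with rfl | hne
    · simp [pairs]
    obtain ⟨S, hSR, hS, hb⟩ := h R hR hne
    have h1 := card_pairs_le_add m hb
    have h2 := ih (R \ S) (Finset.sdiff_ssubset hSR hS) (hR.mono_left Finset.sdiff_subset)
    have h3 := Finset.card_sdiff_add_card_eq_card hSR
    rw [← h3, mul_add]
    omega

open Classical in
theorem two_mul_ncard_edgesAtMostOneEnd [Fintype V] (K : Finset V) :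
    2 * (edgesAtMostOneEnd G (K : Set V)).ncard = (pairs G K Kᶜ).card := by
  let H : SimpleGraph V :=
    { Adj := fun u v => G.Adj u v ∧ (u ∉ K ∨ v ∉ K)
      symm := ⟨fun u v h => ⟨h.1.symm, h.2.symm⟩⟩
      loopless := ⟨fun u h => G.loopless.irrefl u h.1⟩ }
  have hE : edgesAtMostOneEnd G (K : Set V) = H.edgeSet := by
    ext e
    induction e with
    | h x y =>
      simp only [edgesAtMostOneEnd, Set.mem_ofPred_eq, SimpleGraph.mem_edgeSet, Sym2.mem_iff, H]
      refine and_congr_right fun hadj => ?_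
      rw [Set.ncard_le_one_iff]
      constructor
      · intro h
        by_contra! hc
        exact hadj.ne (h ⟨Or.inl rfl, hc.1⟩ ⟨Or.inr rfl, hc.2⟩)
      · rintro h a b ⟨ha | ha, ha'⟩ ⟨hb | hb, hb'⟩ <;> subst ha <;> subst hb <;> simp_all
  rw [hE, ← SimpleGraph.coe_edgeFinset, Set.ncard_coe_finset, ← H.sum_degrees_eq_twice_card_edges]
  have : pairs G K Kᶜ =
      (Finset.univ.sigma fun u => H.neighborFinset u).image (fun a => (a.1, a.2)) := by
    ext ⟨x, y⟩
    simp only [pairs, Finset.mem_filter, Finset.mem_univ, true_and, Finset.mem_image,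
      Finset.mem_sigma, SimpleGraph.mem_neighborFinset, Finset.mem_union, Finset.mem_compl, H]
    constructor
    · rintro ⟨h1, -, -, h2⟩
      exact ⟨⟨x, y⟩, ⟨h1, h2⟩, rfl⟩
    · rintro ⟨⟨a, b⟩, h, he⟩
      simp only [Prod.mk.injEq] at he
      obtain ⟨rfl, rfl⟩ := he
      exact ⟨h.1, by tauto, by tauto, h.2⟩
  rw [this, Finset.card_image_of_injective, Finset.card_sigma]
  · rfl
  · rintro ⟨a, b⟩ ⟨a', b'⟩ h
    simp only [Prod.mk.injEq] at h
    obtain ⟨rfl, rfl⟩ := h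
    rfl

/-- Two sets of positions on a cycle of length `c`, written as subsets of `{0, …, c - 1}` with
`0 ∈ A` and `B ⊄ {0}`: if distinct positions are never cyclically consecutive and a position
of `A` is always at cyclic distance at least `ℓ + 2` from any other position of `B`, then
`2 |A ∪ B| + 2 ℓ ≤ c`. -/
theorem two_mul_card_union_add_le {c ℓ : ℕ} {A B : Finset ℕ} (h0 : 0 ∈ A)
    (hB : ∃ b ∈ B, b ≠ 0) (hB' : ∀ i ∈ B, i < c)
    (h2 : ∀ i ∈ A ∪ B, ∀ j ∈ A ∪ B, i < j → 2 ≤ j - i ∧ j - i + 2 ≤ c)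
    (hAB : ∀ i ∈ A, ∀ j ∈ B, i < j → ℓ + 2 ≤ j - i ∧ j - i + (ℓ + 2) ≤ c)
    (hBA : ∀ i ∈ B, ∀ j ∈ A, i < j → ℓ + 2 ≤ j - i ∧ j - i + (ℓ + 2) ≤ c) :
    2 * (A ∪ B).card + 2 * ℓ ≤ c := by
  -- `p` and `q` are the first and the last position of `B` after `0`. The `ℓ` positions before `p`
  -- and the `ℓ` positions from `q + 2` on are free, besides the successors of `A ∪ B`.
  have hne : (B.erase 0).Nonempty := by
    obtain ⟨b, hb, hb0⟩ := hB
    exact ⟨b, Finset.mem_erase.2 ⟨hb0, hb⟩⟩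
  obtain ⟨hp0, hpB⟩ := Finset.mem_erase.1 ((B.erase 0).min'_mem hne)
  obtain ⟨hq0, hqB⟩ := Finset.mem_erase.1 ((B.erase 0).max'_mem hne)
  have hpmin : ∀ b ∈ B, b ≠ 0 → (B.erase 0).min' hne ≤ b := fun b hb hb0 =>
    Finset.min'_le _ _ (Finset.mem_erase.2 ⟨hb0, hb⟩)
  have hqmax : ∀ b ∈ B, b ≠ 0 → b ≤ (B.erase 0).max' hne := fun b hb hb0 =>
    Finset.le_max' _ _ (Finset.mem_erase.2 ⟨hb0, hb⟩)
  set p := (B.erase 0).min' hne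
  set q := (B.erase 0).max' hne
  have hpq : p ≤ q := hpmin q hqB hq0
  have hp := hAB 0 h0 p hpB (by omega)
  have hq := hAB 0 h0 q hqB (by omega)
  have hU0 : 0 ∈ A ∪ B := Finset.mem_union_left _ h0
  have hUp : ∀ u ∈ A ∪ B, u < p → u + (ℓ + 2) ≤ p := by
    intro u hu hup
    rcases Finset.mem_union.1 hu with hu | hu
    · have := hAB u hu p hpB hup
      omega
    · by_cases h : u = 0
      · omega
      · have := hpmin u hu h
        omega
  have hUq : ∀ u ∈ A ∪ B, q < u → q + (ℓ + 2) ≤ u := by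
    intro u hu hup
    rcases Finset.mem_union.1 hu with hu | hu
    · have := hBA q hqB u hu hup
      omega
    · have := hqmax u hu (by omega)
      omega
  have hUc : ∀ u ∈ A ∪ B, u + 2 ≤ c := by
    intro u hu
    by_cases h : u = 0
    · omega
    · have := h2 0 hU0 u hu (by omega)
      omega
  let S := (A ∪ B).image (· + 1)
  have hS : S.card = (A ∪ B).card := Finset.card_image_of_injective _ (add_left_injective 1)
  have d1 : Disjoint (A ∪ B) S := by
    rw [Finset.disjoint_left]
    intro x hx hx'
    obtain ⟨y, hy, rfl⟩ := Finset.mem_image.1 hx'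
    have := h2 y hy _ hx (by omega)
    omega
  have d2 : Disjoint (A ∪ B ∪ S) (Finset.Ico (p - ℓ) p) := by
    rw [Finset.disjoint_left]
    intro x hx hx'
    rw [Finset.mem_Ico] at hx'
    rcases Finset.mem_union.1 hx with hx | hx
    · have := hUp x hx hx'.2
      omega
    · obtain ⟨y, hy, rfl⟩ := Finset.mem_image.1 hx
      have := hUp y hy (by omega)
      omega
  have d3 : Disjoint (A ∪ B ∪ S ∪ Finset.Ico (p - ℓ) p) (Finset.Ico (q + 2) (q + 2 + ℓ)) := by
    rw [Finset.disjoint_left]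
    intro x hx hx'
    rw [Finset.mem_Ico] at hx'
    rcases Finset.mem_union.1 hx with hx | hx
    · rcases Finset.mem_union.1 hx with hx | hx
      · have := hUq x hx (by omega)
        omega
      · obtain ⟨y, hy, rfl⟩ := Finset.mem_image.1 hx
        have := hUq y hy (by omega)
        omega
    · rw [Finset.mem_Ico] at hx
      omega
  have hsub : A ∪ B ∪ S ∪ Finset.Ico (p - ℓ) p ∪ Finset.Ico (q + 2) (q + 2 + ℓ) ⊆
      Finset.range c := by
    intro x hx
    rw [Finset.mem_range]
    rcases Finset.mem_union.1 hx with hx | hx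
    · rcases Finset.mem_union.1 hx with hx | hx
      · rcases Finset.mem_union.1 hx with hx | hx
        · have := hUc x hx
          omega
        · obtain ⟨y, hy, rfl⟩ := Finset.mem_image.1 hx
          have := hUc y hy
          omega
      · have := hB' p hpB
        rw [Finset.mem_Ico] at hx
        omega
    · rw [Finset.mem_Ico] at hx
      omega
  have := Finset.card_le_card hsub
  rw [Finset.card_union_of_disjoint d3, Finset.card_union_of_disjoint d2,
    Finset.card_union_of_disjoint d1, hS, Nat.card_Ico, Nat.card_Ico, Finset.card_range] at this
  omega

/-- Positions on a cycle of length `c` at pairwise cyclic distance at least `q`, one of them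
being `0`. -/
theorem card_mul_le_of_spread {c q : ℕ} {A : Finset ℕ} (h0 : 0 ∈ A) (hA : 2 ≤ A.card)
    (h : ∀ i ∈ A, ∀ j ∈ A, i < j → q ≤ j - i ∧ j - i + q ≤ c) : A.card * q ≤ c := by
  have hc : ∀ u ∈ A, u + q ≤ c := by
    intro u hu
    rcases Nat.eq_zero_or_pos u with rfl | hu0
    · obtain ⟨b, hb, hb0⟩ := Finset.exists_mem_ne hA 0
      have := h 0 h0 b hb (by omega)
      omega
    · have := h 0 h0 u hu hu0
      omega
  have := Finset.card_le_card_of_injOn (s := A ×ˢ Finset.range q) (t := Finset.range c)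
    (fun a => a.1 + a.2)
    (by
      rintro ⟨a, b⟩ hab
      simp only [Finset.coe_product, Set.mem_prod, Finset.mem_coe, Finset.mem_range] at hab ⊢
      have := hc a hab.1
      omega)
    (by
      rintro ⟨a, b⟩ hab ⟨a', b'⟩ hab' he
      simp only [Finset.coe_product, Set.mem_prod, Finset.mem_coe, Finset.mem_range] at hab hab' he
      rcases lt_trichotomy a a' with hlt | rfl | hlt
      · have := h a hab.1 a' hab'.1 hlt
        omega
      · simp only [Prod.mk.injEq, true_and]
        omega
      · have := h a' hab'.1 a hab.1 hlt
        omega)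
  simpa using this

/-! ### Longest paths with a fixed end; paths attached to a longest cycle -/

/-- `p 0, …, p L` is a path of `G` that ends in the root `z` and whose other vertices lie in `T`. -/
structure IsRootedPath (G : SimpleGraph V) (T : Finset V) (z : V) (p : ℕ → V) (L : ℕ) : Prop where
  path : IsPathSeq G p L
  mem : ∀ i < L, p i ∈ T
  root : p L = z

theorem IsRootedPath.rotation {T : Finset V} {z : V} {p : ℕ → V} {L i : ℕ}
    (hp : IsRootedPath G T z p L) (hi : i < L) (h : G.Adj (p 0) (p (i + 1))) :
    IsRootedPath G T z (rotation p i) L := by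
  refine ⟨hp.path.rotation hi h, fun j hj => ?_, ?_⟩
  · obtain ⟨a, ha, he⟩ := rotation_eq p (m := L - 1) (i := i) (j := j) (by omega) (by omega)
    rw [he]
    exact hp.mem a (by omega)
  · rw [rotation_of_lt p hi, hp.root]

/-- In a longest rooted path, the neighbours of the first vertex lie on the path as soon as they
lie in `T` or are the root. -/
theorem IsRootedPath.exists_eq_of_adj {T : Finset V} {z : V} {p : ℕ → V} {L : ℕ}
    (hp : IsRootedPath G T z p L) (hmax : ∀ q M, IsRootedPath G T z q M → M ≤ L) {v : V}
    (hv : v ∈ T ∨ v = z) (h : G.Adj (p 0) v) : ∃ j, 1 ≤ j ∧ j ≤ L ∧ p j = v := by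
  by_cases hex : ∃ j ≤ L, p j = v
  · obtain ⟨j, hj, rfl⟩ := hex
    refine ⟨j, ?_, hj, rfl⟩
    by_contra hj0
    obtain rfl : j = 0 := by omega
    exact h.ne rfl
  · push Not at hex
    have hvT : v ∈ T := hv.resolve_right fun hvz => hex L le_rfl (hp.root.trans hvz.symm)
    have := hmax _ (L + 1) ⟨hp.path.cons h.symm hex, fun i hi => ?_, by simpa using hp.root⟩
    · omega
    · split_ifs
      · exact hvT
      · exact hp.mem _ (by omega)

open Classical in
/-- The rotation argument behind the Erdős–Gallai theorem on cycles. If no cycle inside `T ∪ {z}`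
has `2 k - 1` or more vertices, the path rotations of a suitable longest path that ends in `z` yield
a set `S ⊆ T` that meets at most `(k - 1) |S|` edges, counted by degrees. -/
theorem exists_sparse_of_rotation [Fintype V] {T X : Finset V} {z : V} {k L : ℕ} (hk : 2 ≤ k)
    (hTX : T ⊆ X) (hzX : z ∈ X) (hL : 1 ≤ L) (hex : ∃ p, IsRootedPath G T z p L)
    (hmax : ∀ p M, IsRootedPath G T z p M → M ≤ L)
    (hN : ∀ p, IsRootedPath G T z p L → ∀ v ∈ X, G.Adj (p 0) v → v ∈ T ∨ v = z)
    (hcyc : ∀ g m, IsCycleSeq G g m → (∀ i < m, g i ∈ T ∨ g i = z) → m + 2 ≤ 2 * k) :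
    ∃ S ⊆ T, S.Nonempty ∧
      ∀ u ∈ S, (nbrsIn G X u).card + (nbrsIn G X u \ S).card ≤ 2 * (k - 1) := by
  -- Among the longest rooted paths, `p` has a first vertex of largest degree `d`. The `d` vertices
  -- that rotations of `p` put in first place form `S`: their degrees are at most `d`, and all their
  -- neighbours are among the first `2 k - 2` vertices of `p`, which include `S`.
  obtain ⟨p, hp, hdeg⟩ := exists_maximal_nat (fun p => IsRootedPath G T z p L)
    (fun p => (nbrsIn G X (p 0)).card) (Fintype.card V) (fun _ _ => Finset.card_le_univ _) hex
  have key : ∀ q, IsRootedPath G T z q L → ∀ v ∈ nbrsIn G X (q 0),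
      ∃ j, 1 ≤ j ∧ j ≤ L ∧ j + 3 ≤ 2 * k ∧ q j = v := by
    intro q hq v hv
    obtain ⟨hvX, hadj⟩ := mem_nbrsIn.1 hv
    obtain ⟨j, h1, h2, rfl⟩ := hq.exists_eq_of_adj hmax (hN q hq v hvX hadj) hadj
    refine ⟨j, h1, h2, ?_, rfl⟩
    by_cases hj : 2 ≤ j
    · have := hcyc q (j + 1) (hq.path.isCycleSeq hj h2 hadj) fun i hi => ?_
      · omega
      · rcases Nat.lt_or_ge i L with hiL | hiL
        · exact Or.inl (hq.mem i hiL)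
        · obtain rfl : i = L := by omega
          exact Or.inr hq.root
    · omega
  let I := (Finset.range L).filter fun i => p (i + 1) ∈ nbrsIn G X (p 0)
  have hI : ∀ i ∈ I, i < L ∧ p (i + 1) ∈ nbrsIn G X (p 0) := fun i hi => by
    simpa [I] using hi
  have hS : (I.image p).card = I.card := Finset.card_image_of_injOn fun a ha b hb hab =>
    hp.path.inj a (hI a ha).1.le b (hI b hb).1.le hab
  have hNI : nbrsIn G X (p 0) = I.image fun i => p (i + 1) := by
    ext v
    rw [Finset.mem_image]
    constructor
    · intro hv
      obtain ⟨j, h1, h2, -, rfl⟩ := key p hp v hv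
      have hj : j - 1 + 1 = j := by omega
      refine ⟨j - 1, ?_, by rw [hj]⟩
      simp only [I, Finset.mem_filter, Finset.mem_range, hj]
      exact ⟨by omega, hv⟩
    · rintro ⟨i, hi, rfl⟩
      exact (hI i hi).2
  have hd : (nbrsIn G X (p 0)).card = I.card := by
    rw [hNI]
    refine Finset.card_image_of_injOn fun a ha b hb hab => ?_
    have := hp.path.inj (a + 1) (hI a ha).1 (b + 1) (hI b hb).1 hab
    omega
  have hIk : ∀ i ∈ I, i + 4 ≤ 2 * k := by
    intro i hi
    obtain ⟨j, h1, h2, h3, h4⟩ := key p hp _ (hI i hi).2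
    have := hp.path.inj _ h2 _ (hI i hi).1 h4
    omega
  refine ⟨I.image p, ?_, ?_, ?_⟩
  · intro u hu
    obtain ⟨i, hi, rfl⟩ := Finset.mem_image.1 hu
    exact hp.mem i (hI i hi).1
  · refine ⟨p 0, Finset.mem_image.2 ⟨0, ?_, rfl⟩⟩
    simp only [I, Finset.mem_filter, Finset.mem_range, zero_add]
    refine ⟨hL, mem_nbrsIn.2 ⟨?_, hp.path.adj 0 hL⟩⟩
    rcases Nat.lt_or_ge 1 L with h | h
    · exact hTX (hp.mem 1 h)
    · obtain rfl : L = 1 := by omega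
      rwa [hp.root]
  · intro u hu
    obtain ⟨i, hi, rfl⟩ := Finset.mem_image.1 hu
    have hrot := hp.rotation (hI i hi).1 (mem_nbrsIn.1 (hI i hi).2).2
    have h1 := hdeg _ hrot
    simp only [rotation_zero] at h1
    have hsub : nbrsIn G X (p i) \ I.image p ⊆
        (Finset.range (2 * k - 2)).image p \ I.image p := by
      refine Finset.sdiff_subset_sdiff (fun v hv => ?_) le_rfl
      rw [← rotation_zero p i] at hv
      obtain ⟨j, -, -, h3, rfl⟩ := key _ hrot v hv
      have := hIk i hi
      obtain ⟨a, ha, he⟩ := rotation_eq p (m := 2 * k - 3) (i := i) (j := j) (by omega) (by omega)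
      exact Finset.mem_image.2 ⟨a, Finset.mem_range.2 (by omega), he.symm⟩
    have h2 := Finset.card_le_card hsub
    rw [Finset.card_sdiff_of_subset (Finset.image_subset_image fun i hi => by
      have := hIk i hi
      rw [Finset.mem_range]
      omega)] at h2
    have h3 := Finset.card_image_le (s := Finset.range (2 * k - 2)) (f := p)
    have h4 : (I.image p).card ≤ ((Finset.range (2 * k - 2)).image p).card :=
      Finset.card_le_card (Finset.image_subset_image fun i hi => by
        have := hIk i hi
        rw [Finset.mem_range]
        omega)
    rw [Finset.card_range] at h3
    omega

/-- `f` runs periodically, with period `c`, through the vertices of a cycle of `G` with vertex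
set `K`: consecutive values are adjacent, and values coincide only at indices congruent
modulo `c`. -/
structure IsCyclicEnum (G : SimpleGraph V) (K : Finset V) (c : ℕ) (f : ℕ → V) : Prop where
  adj : ∀ i, G.Adj (f i) (f (i + 1))
  period : ∀ i, f (i + c) = f i
  inj : ∀ i j, f i = f j → i % c = j % c
  mem_iff : ∀ x, x ∈ K ↔ ∃ i < c, f i = x

theorem IsCyclicEnum.mem {K : Finset V} {c : ℕ} {f : ℕ → V} (hf : IsCyclicEnum G K c f)
    (hc : 0 < c) (i : ℕ) : f i ∈ K := by
  have h : ∀ q r, f (r + c * q) = f r := by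
    intro q r
    induction q with
    | zero => simp
    | succ q ih => rw [Nat.mul_succ, ← add_assoc, hf.period, ih]
  rw [hf.mem_iff]
  refine ⟨i % c, Nat.mod_lt _ hc, ?_⟩
  conv_rhs => rw [← Nat.mod_add_div i c]
  exact (h _ _).symm

/-- A path outside a longest cycle, attached to the cycle at both ends, is no longer than the
part of the cycle it could replace. -/
theorem IsCyclicEnum.add_two_le {K : Finset V} {c : ℕ} {f : ℕ → V} (hf : IsCyclicEnum G K c f)
    (hlong : ∀ g m, IsCycleSeq G g m → m ≤ c) {p : ℕ → V} {ℓ : ℕ} (hp : IsPathSeq G p ℓ)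
    (hpK : ∀ i ≤ ℓ, p i ∉ K) {i d : ℕ} (hd : 0 < d) (hdc : d < c) (h0 : G.Adj (p 0) (f i))
    (hℓ : G.Adj (p ℓ) (f (i + d))) : ℓ + 2 ≤ d := by
  have hc : 0 < c := by omega
  have hg : IsCycleSeq G (fun j => if j ≤ c - d then f (i + d + j) else p (j - (c - d + 1)))
      (c - d + 1 + (ℓ + 1)) := by
    refine ⟨by omega, ⟨fun a ha b hb hab => ?_, fun a ha => ?_⟩, ?_⟩
    · split_ifs at hab with h1 h2 h2
      · have h := Nat.ModEq.add_left_cancel' (i + d) (hf.inj _ _ hab)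
        rw [Nat.ModEq, Nat.mod_eq_of_lt (by omega), Nat.mod_eq_of_lt (by omega)] at h
        exact h
      · exact absurd (hab ▸ hf.mem hc _) (hpK _ (by omega))
      · exact absurd (hab ▸ hf.mem hc _) (hpK _ (by omega))
      · have := hp.inj _ (by omega) _ (by omega) hab
        omega
    · split_ifs with h1 h2 h2
      · exact hf.adj _
      · obtain rfl : a = c - d := by omega
        rw [show i + d + (c - d) = i + c by omega, hf.period]
        simpa using h0.symm
      · omega
      · have := hp.adj (a - (c - d + 1)) (by omega)
        rwa [show a - (c - d + 1) + 1 = a + 1 - (c - d + 1) by omega] at this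
    · rw [if_neg (by omega), if_pos (by omega), add_zero]
      rwa [show c - d + 1 + (ℓ + 1) - 1 - (c - d + 1) = ℓ by omega]
  have := hlong _ _ hg
  omega

open Classical in
/-- How the neighbours of the two ends of a path outside a longest cycle are spread over the
cycle. -/
theorem IsCyclicEnum.card_nbrsIn {K : Finset V} {c : ℕ} {f : ℕ → V} (hf : IsCyclicEnum G K c f)
    (hlong : ∀ g m, IsCycleSeq G g m → m ≤ c) {p : ℕ → V} {ℓ : ℕ} (hp : IsPathSeq G p ℓ)
    (hpK : ∀ i ≤ ℓ, p i ∉ K) {a b : V} (ha : a ∈ nbrsIn G K (p 0)) (hb : b ∈ nbrsIn G K (p ℓ))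
    (hab : a ≠ b) :
    2 * (nbrsIn G K (p 0) ∪ nbrsIn G K (p ℓ)).card + 2 * ℓ ≤ c ∧
      (nbrsIn G K (p 0) = nbrsIn G K (p ℓ) → (nbrsIn G K (p 0)).card * (ℓ + 2) ≤ c) := by
  obtain ⟨i0, hi0, hfa⟩ := (hf.mem_iff a).1 (mem_nbrsIn.1 ha).1
  have hc : 0 < c := by omega
  -- The positions of the members of `Y` on the cycle, counted from `a`.
  let idx : Finset V → Finset ℕ := fun Y => (Finset.range c).filter fun j => f (i0 + j) ∈ Y
  have hidx : ∀ Y j, j ∈ idx Y ↔ j < c ∧ f (i0 + j) ∈ Y := fun Y j => by simp [idx]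
  have hsurj : ∀ y ∈ K, ∃ j < c, f (i0 + j) = y := by
    intro y hy
    obtain ⟨i, hi, rfl⟩ := (hf.mem_iff y).1 hy
    rcases Nat.lt_or_ge i i0 with h | h
    · refine ⟨i + c - i0, by omega, ?_⟩
      rw [show i0 + (i + c - i0) = i + c by omega, hf.period]
    · refine ⟨i - i0, by omega, ?_⟩
      rw [show i0 + (i - i0) = i by omega]
  have hcard : ∀ Y ⊆ K, (idx Y).card = Y.card := by
    intro Y hY
    have himg : (idx Y).image (fun j => f (i0 + j)) = Y := by
      ext y
      rw [Finset.mem_image]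
      constructor
      · rintro ⟨j, hj, rfl⟩
        exact ((hidx _ _).1 hj).2
      · intro hy
        obtain ⟨j, hj, rfl⟩ := hsurj y (hY hy)
        exact ⟨j, (hidx _ _).2 ⟨hj, hy⟩, rfl⟩
    conv_rhs => rw [← himg]
    refine (Finset.card_image_of_injOn fun j hj j' hj' h => ?_).symm
    have h := Nat.ModEq.add_left_cancel' i0 (hf.inj _ _ h)
    rwa [Nat.ModEq, Nat.mod_eq_of_lt ((hidx _ _).1 hj).1,
      Nat.mod_eq_of_lt ((hidx _ _).1 hj').1] at h
  -- Attachments of a path at both ends are far apart in both directions.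
  have hgap : ∀ (q : ℕ → V) (m : ℕ), IsPathSeq G q m → (∀ i ≤ m, q i ∉ K) →
      ∀ i j, i < j → j < c → G.Adj (q 0) (f (i0 + i)) → G.Adj (q m) (f (i0 + j)) →
      m + 2 ≤ j - i ∧ j - i + (m + 2) ≤ c := by
    intro q m hq hqK i j hij hj h0 hm
    constructor
    · refine hf.add_two_le hlong hq hqK (i := i0 + i) (by omega) (by omega) h0 ?_
      rwa [show i0 + i + (j - i) = i0 + j by omega]
    · have := hf.add_two_le hlong hq.reverse (fun i _ => hqK _ (by omega)) (i := i0 + j)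
        (d := c - (j - i)) (by omega) (by omega) (by simpa using hm) (by
          rw [show i0 + j + (c - (j - i)) = i0 + i + c by omega, hf.period]
          simpa using h0)
      omega
  have hAB : ∀ i ∈ idx (nbrsIn G K (p 0)), ∀ j ∈ idx (nbrsIn G K (p ℓ)), i < j →
      ℓ + 2 ≤ j - i ∧ j - i + (ℓ + 2) ≤ c := by
    intro i hi j hj hij
    rw [hidx, mem_nbrsIn] at hi hj
    exact hgap p ℓ hp hpK i j hij hj.1 hi.2.2 hj.2.2
  have hBA : ∀ i ∈ idx (nbrsIn G K (p ℓ)), ∀ j ∈ idx (nbrsIn G K (p 0)), i < j →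
      ℓ + 2 ≤ j - i ∧ j - i + (ℓ + 2) ≤ c := by
    intro i hi j hj hij
    rw [hidx, mem_nbrsIn] at hi hj
    exact hgap _ ℓ hp.reverse (fun i _ => hpK _ (by omega)) i j hij hj.1
      (by simpa using hi.2.2) (by simpa using hj.2.2)
  have hsame : ∀ m ≤ ℓ, ∀ i ∈ idx (nbrsIn G K (p m)), ∀ j ∈ idx (nbrsIn G K (p m)), i < j →
      2 ≤ j - i ∧ j - i + 2 ≤ c := by
    intro m hm i hi j hj hij
    rw [hidx, mem_nbrsIn] at hi hj
    exact hgap _ 0 (IsPathSeq.single (p m)) (fun _ _ => hpK m hm) i j hij hj.1 hi.2.2 hj.2.2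
  have h0 : 0 ∈ idx (nbrsIn G K (p 0)) := (hidx _ _).2 ⟨hc, by simpa [hfa] using ha⟩
  have hsubK : ∀ u, nbrsIn G K u ⊆ K := fun u v hv => (mem_nbrsIn.1 hv).1
  have hunion : idx (nbrsIn G K (p 0)) ∪ idx (nbrsIn G K (p ℓ)) =
      idx (nbrsIn G K (p 0) ∪ nbrsIn G K (p ℓ)) := by
    ext j
    simp only [Finset.mem_union, hidx]
    tauto
  obtain ⟨jb, hjb, hfb⟩ := hsurj b (mem_nbrsIn.1 hb).1
  have hjb' : jb ∈ idx (nbrsIn G K (p ℓ)) := (hidx _ _).2 ⟨hjb, hfb ▸ hb⟩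
  have hjb0 : jb ≠ 0 := by
    rintro rfl
    exact hab (by rw [← hfa, ← hfb, add_zero])
  constructor
  · rw [← hcard _ (Finset.union_subset (hsubK _) (hsubK _)), ← hunion]
    refine two_mul_card_union_add_le h0 ⟨jb, hjb', hjb0⟩ (fun i hi => ((hidx _ _).1 hi).1) ?_
      hAB hBA
    intro i hi j hj hij
    rcases Finset.mem_union.1 hi with hi | hi <;> rcases Finset.mem_union.1 hj with hj | hj
    · exact hsame 0 (by omega) i hi j hj hij
    · have := hAB i hi j hj hij
      omega
    · have := hBA i hi j hj hij
      omega
    · exact hsame ℓ le_rfl i hi j hj hij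
  · intro heq
    rw [← hcard _ (hsubK _)]
    refine card_mul_le_of_spread h0 ?_ fun i hi j hj hij => hAB i hi j (heq ▸ hj) hij
    rw [hcard _ (hsubK _)]
    exact Finset.one_lt_card.2 ⟨a, ha, b, heq ▸ hb, hab⟩

/-! ### Sparse sets off a longest cycle -/

open Classical in
theorem nbrsIn_union (X Y : Finset V) (u : V) :
    nbrsIn G (X ∪ Y) u = nbrsIn G X u ∪ nbrsIn G Y u := by
  ext v
  simp only [mem_nbrsIn, Finset.mem_union]
  tauto

theorem IsPathSeq.isRootedPath_snoc {R K : Finset V} (hRK : Disjoint R K) {q : ℕ → V} {ℓ : ℕ}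
    {w : V} (hq : IsPathSeq G q ℓ) (hqR : ∀ i ≤ ℓ, q i ∈ R) (hw : w ∈ nbrsIn G K (q ℓ)) :
    IsRootedPath G R w (fun i => if i ≤ ℓ then q i else w) (ℓ + 1) := by
  obtain ⟨hwK, hadj⟩ := mem_nbrsIn.1 hw
  have hne : ∀ i ≤ ℓ, q i ≠ w := fun i hi h =>
    Finset.disjoint_left.1 hRK (hqR i hi) (h ▸ hwK)
  refine ⟨⟨fun i hi j hj h => ?_, fun i hi => ?_⟩, fun i hi => ?_, by simp⟩
  · split_ifs at h with h1 h2 h2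
    · exact hq.inj i h1 j h2 h
    · exact absurd h (hne i h1)
    · exact absurd h.symm (hne j h2)
    · omega
  · rw [if_pos (by omega)]
    split_ifs with h
    · exact hq.adj i (by omega)
    · obtain rfl : i = ℓ := by omega
      exact hadj
  · rw [if_pos (by omega)]
    exact hqR i (by omega)

open Classical in
/-- The case of a longest path outside the cycle, both of whose ends have neighbours on the
cycle, not all equal to a single vertex. Its two ends have the same neighbours on the cycle, and
the spread of these leaves room for two of them only; the vertices of the path then form `S`. -/
theorem IsCyclicEnum.exists_sparse_of_attached [Fintype V] {K R : Finset V} {c : ℕ} {f : ℕ → V}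
    (hf : IsCyclicEnum G K c f) (hlong : ∀ g m, IsCycleSeq G g m → m ≤ c)
    (h6 : c ≠ 6) (h7 : c ≠ 7) (h9 : c ≠ 9) (hcard : ∀ u ∉ K, (nbrsIn G K u).card ≠ c / 2)
    (hRK : Disjoint R K) (hdeg : ∀ u ∈ R, c / 2 ≤ (nbrsIn G (R ∪ K) u).card) {p : ℕ → V} {ℓ : ℕ}
    (hp : IsPathSeq G p ℓ) (hpR : ∀ i ≤ ℓ, p i ∈ R)
    (hmax : ∀ z ∈ K, ∀ q M, IsRootedPath G R z q M → M ≤ ℓ + 1) {a b : V}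
    (ha : a ∈ nbrsIn G K (p 0)) (hb : b ∈ nbrsIn G K (p ℓ)) (hab : a ≠ b) :
    ∃ S ⊆ R, S.Nonempty ∧ ∀ u ∈ S,
      (nbrsIn G (R ∪ K) u).card + (nbrsIn G (R ∪ K) u \ S).card ≤ 2 * (c / 2 - 1) := by
  have hnot : ∀ v ∈ R, v ∉ K := fun v hv => Finset.disjoint_left.1 hRK hv
  have hnbr : ∀ q, IsPathSeq G q ℓ → (∀ i ≤ ℓ, q i ∈ R) → (nbrsIn G K (q ℓ)).Nonempty →
      nbrsIn G R (q 0) ⊆ (Finset.range ℓ).image fun i => q (i + 1) := by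
    rintro q hq hqR ⟨w, hw⟩ v hv
    obtain ⟨hvR, hadj⟩ := mem_nbrsIn.1 hv
    obtain ⟨j, h1, h2, h3⟩ := (hq.isRootedPath_snoc hRK hqR hw).exists_eq_of_adj
      (hmax w (mem_nbrsIn.1 hw).1) (Or.inl hvR) (by simpa using hadj)
    split_ifs at h3 with h
    · refine Finset.mem_image.2 ⟨j - 1, Finset.mem_range.2 (by omega), ?_⟩
      rw [← h3, show j - 1 + 1 = j by omega]
    · exact absurd (h3 ▸ (mem_nbrsIn.1 hw).1) (hnot v hvR)
  have hnbr_card : ∀ q, IsPathSeq G q ℓ → (∀ i ≤ ℓ, q i ∈ R) → (nbrsIn G K (q ℓ)).Nonempty →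
      (nbrsIn G R (q 0)).card ≤ ℓ := by
    intro q hq hqR hne
    simpa using (Finset.card_le_card (hnbr q hq hqR hne)).trans Finset.card_image_le
  have hlow : ∀ q, IsPathSeq G q ℓ → (∀ i ≤ ℓ, q i ∈ R) → (nbrsIn G K (q ℓ)).Nonempty →
      c / 2 ≤ (nbrsIn G K (q 0)).card + ℓ := by
    intro q hq hqR hne
    have h1 := hdeg (q 0) (hqR 0 (by omega))
    have h2 := Finset.card_union_le (nbrsIn G R (q 0)) (nbrsIn G K (q 0))
    have h3 := hnbr_card q hq hqR hne
    rw [nbrsIn_union] at h1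
    omega
  have hends : ∀ q, IsPathSeq G q ℓ → (∀ i ≤ ℓ, q i ∈ R) → ∀ x ∈ nbrsIn G K (q 0),
      ∀ y ∈ nbrsIn G K (q ℓ), x ≠ y → nbrsIn G K (q 0) = nbrsIn G K (q ℓ) ∧
        (nbrsIn G K (q 0)).card + ℓ = c / 2 ∧ (nbrsIn G K (q 0)).card * (ℓ + 2) ≤ c := by
    intro q hq hqR x hx y hy hxy
    obtain ⟨h1, h2⟩ := hf.card_nbrsIn hlong hq (fun i hi => hnot _ (hqR i hi)) hx hy hxy
    have h3 := hlow q hq hqR ⟨y, hy⟩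
    have h4 := hlow _ hq.reverse (fun i _ => hqR _ (by omega)) ⟨x, by simpa using hx⟩
    simp only [Nat.sub_zero] at h4
    have h5 := Finset.eq_of_subset_of_card_le
      (Finset.subset_union_left (s₁ := nbrsIn G K (q 0)) (s₂ := nbrsIn G K (q ℓ))) (by omega)
    have h6 := Finset.eq_of_subset_of_card_le
      (Finset.subset_union_right (s₁ := nbrsIn G K (q 0)) (s₂ := nbrsIn G K (q ℓ))) (by omega)
    have heq := h5.trans h6.symm
    rw [← h5] at h1
    exact ⟨heq, by omega, h2 heq⟩
  obtain ⟨heq, hsum, hmul⟩ := hends p hp hpR a ha b hb hab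
  have hs2 : 1 < (nbrsIn G K (p 0)).card := Finset.one_lt_card.2 ⟨a, ha, b, heq ▸ hb, hab⟩
  have hℓ0 : 1 ≤ ℓ := by
    have := hcard _ (hnot _ (hpR 0 (by omega)))
    omega
  -- With `s` common neighbours, `ℓ = c / 2 - s` and `s (ℓ + 2) ≤ c` give `(s - 2) ℓ ≤ 1`.
  have hs : (nbrsIn G K (p 0)).card = 2 := by
    obtain ⟨e, he⟩ := Nat.exists_eq_add_of_le (show 2 ≤ (nbrsIn G K (p 0)).card from hs2)
    rw [he] at hmul hsum ⊢
    have h1 : e * ℓ ≤ 1 := by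
      have : c ≤ 2 * (2 + e + ℓ) + 1 := by omega
      nlinarith
    rcases Nat.eq_zero_or_pos e with rfl | he0
    · rfl
    · have h2 : e ≤ 1 := (Nat.le_mul_of_pos_right e hℓ0).trans h1
      have h3 : ℓ ≤ 1 := (Nat.le_mul_of_pos_left ℓ he0).trans h1
      obtain rfl : e = 1 := by omega
      obtain rfl : ℓ = 1 := by omega
      omega
  have hℓ2 : 2 ≤ ℓ := by omega
  -- The first vertex is adjacent to the whole path, so every vertex of the path is the first
  -- one of some path with the same vertices.
  have hall : ∀ i < ℓ, G.Adj (p 0) (p (i + 1)) := by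
    have h1 := hdeg (p 0) (hpR 0 (by omega))
    have h2 := Finset.card_union_le (nbrsIn G R (p 0)) (nbrsIn G K (p 0))
    rw [nbrsIn_union] at h1
    have h3 := Finset.eq_of_subset_of_card_le (hnbr p hp hpR ⟨b, hb⟩)
      (Finset.card_image_le.trans (by rw [Finset.card_range]; omega))
    intro i hi
    have : p (i + 1) ∈ nbrsIn G R (p 0) := by
      rw [h3]
      exact Finset.mem_image.2 ⟨i, Finset.mem_range.2 hi, rfl⟩
    exact (mem_nbrsIn.1 this).2
  let S := (Finset.range (ℓ + 1)).image p
  have hmemS : ∀ i ≤ ℓ, p i ∈ S := fun i hi =>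
    Finset.mem_image.2 ⟨i, Finset.mem_range.2 (by omega), rfl⟩
  have hfirst : ∀ q, IsPathSeq G q ℓ → (∀ i ≤ ℓ, ∃ j ≤ ℓ, q i = p j) →
      (nbrsIn G K (q ℓ)).card = 2 →
      (nbrsIn G (R ∪ K) (q 0)).card + (nbrsIn G (R ∪ K) (q 0) \ S).card ≤ 2 * (c / 2 - 1) := by
    intro q hq hqp hq2
    have hqR : ∀ i ≤ ℓ, q i ∈ R := fun i hi => by
      obtain ⟨j, hj, h⟩ := hqp i hi
      exact h ▸ hpR j hj
    have hne : (nbrsIn G K (q ℓ)).Nonempty := Finset.card_pos.1 (by omega)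
    obtain ⟨x, hx⟩ : (nbrsIn G K (q 0)).Nonempty := Finset.card_pos.1 (by
      have := hlow q hq hqR hne
      omega)
    obtain ⟨y, hy, hyx⟩ := Finset.exists_mem_ne (show 1 < (nbrsIn G K (q ℓ)).card by omega) x
    have h1 := (hends q hq hqR x hx y hy hyx.symm).2.1
    have h2 : nbrsIn G (R ∪ K) (q 0) \ S ⊆ nbrsIn G K (q 0) := by
      intro v hv
      rw [Finset.mem_sdiff, nbrsIn_union, Finset.mem_union] at hv
      refine hv.1.resolve_left fun hvR => hv.2 ?_
      obtain ⟨i, hi, rfl⟩ := Finset.mem_image.1 (hnbr q hq hqR hne hvR)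
      obtain ⟨j, hj, h⟩ := hqp (i + 1) (Finset.mem_range.1 hi)
      exact h ▸ hmemS j hj
    have h3 := Finset.card_le_card h2
    have h4 := hnbr_card q hq hqR hne
    have h5 := Finset.card_union_le (nbrsIn G R (q 0)) (nbrsIn G K (q 0))
    rw [← nbrsIn_union] at h5
    omega
  refine ⟨S, ?_, ⟨_, hmemS 0 (by omega)⟩, ?_⟩
  · intro u hu
    obtain ⟨i, hi, rfl⟩ := Finset.mem_image.1 hu
    exact hpR i (by simpa using hi)
  · intro u hu
    obtain ⟨i, hi, rfl⟩ := Finset.mem_image.1 hu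
    rw [Finset.mem_range] at hi
    rcases Nat.lt_or_ge i ℓ with h | h
    · have := hfirst _ (hp.rotation h (hall i h)) (fun j hj => rotation_eq p h.le hj)
        (by rw [rotation_of_lt p h, ← heq, hs])
      simpa only [rotation_zero] using this
    · obtain rfl : i = ℓ := by omega
      have := hfirst _ hp.reverse (fun j _ => ⟨i - j, by omega, rfl⟩) (by simpa using hs)
      simpa using this

open Classical in
/-- Every nonempty set `R` of vertices off the longest cycle contains a nonempty set `S` that
meets at most `(c / 2 - 1) |S|` edges of `R ∪ K`, counted by degrees. Here `hcyc` says that a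
cycle with at most one vertex in `K` has fewer than `2 (c / 2) - 1` vertices. -/
theorem IsCyclicEnum.exists_sparse [Fintype V] {K R : Finset V} {c : ℕ} {f : ℕ → V}
    (hf : IsCyclicEnum G K c f) (hlong : ∀ g m, IsCycleSeq G g m → m ≤ c)
    (h4 : 4 ≤ c) (h6 : c ≠ 6) (h7 : c ≠ 7) (h9 : c ≠ 9)
    (hcard : ∀ u ∉ K, (nbrsIn G K u).card ≠ c / 2)
    (hcyc : ∀ z g m, IsCycleSeq G g m → (∀ i < m, g i ∉ K ∨ g i = z) → m + 2 ≤ 2 * (c / 2))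
    (hRK : Disjoint R K) (hR : R.Nonempty) :
    ∃ S ⊆ R, S.Nonempty ∧ ∀ u ∈ S,
      (nbrsIn G (R ∪ K) u).card + (nbrsIn G (R ∪ K) u \ S).card ≤ 2 * (c / 2 - 1) := by
  have hnot : ∀ v ∈ R, v ∉ K := fun v hv => Finset.disjoint_left.1 hRK hv
  by_cases hdeg : ∀ u ∈ R, c / 2 ≤ (nbrsIn G (R ∪ K) u).card
  swap
  · push Not at hdeg
    obtain ⟨u, huR, hu⟩ := hdeg
    refine ⟨{u}, by simpa using huR, by simp, ?_⟩
    intro x hx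
    rw [Finset.mem_singleton.1 hx]
    have := Finset.card_le_card (Finset.sdiff_subset (s := nbrsIn G (R ∪ K) u) (t := {u}))
    omega
  by_cases hatt : ∃ u ∈ R, (nbrsIn G K u).Nonempty
  · -- `p` is a longest path of `R` continued by one vertex `w` of the cycle.
    obtain ⟨u, huR, w₀, hw₀⟩ := hatt
    obtain ⟨⟨p, L, w⟩, ⟨hw, hp⟩, hmax⟩ := exists_maximal_nat
      (fun x : (ℕ → V) × ℕ × V => x.2.2 ∈ K ∧ IsRootedPath G R x.2.2 x.1 x.2.1) (fun x => x.2.1)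
      (Fintype.card V) (fun x hx => hx.2.path.length_lt_card.le)
      ⟨⟨_, 1, w₀⟩, (mem_nbrsIn.1 hw₀).1, (IsPathSeq.single u).isRootedPath_snoc hRK
        (fun _ _ => huR) hw₀⟩
    have hmax' : ∀ z ∈ K, ∀ q M, IsRootedPath G R z q M → M ≤ L := fun z hz q M hq =>
      hmax ⟨q, M, z⟩ ⟨hz, hq⟩
    dsimp only at hw hp
    have hL : 1 ≤ L := hmax' w₀ (mem_nbrsIn.1 hw₀).1 _ 1
      ((IsPathSeq.single u).isRootedPath_snoc hRK (fun _ _ => huR) hw₀)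
    by_cases hshort : ∃ q, IsRootedPath G R w q L ∧ ∃ a ∈ nbrsIn G K (q 0), a ≠ w
    · obtain ⟨q, hq, a, ha, haw⟩ := hshort
      have hL' : L - 1 + 1 = L := by omega
      refine hf.exists_sparse_of_attached hlong h6 h7 h9 hcard hRK hdeg
        (hq.path.mono (Nat.sub_le L 1)) (fun i hi => hq.mem i (by omega)) (by rwa [hL']) ha
        (mem_nbrsIn.2 ⟨hw, ?_⟩) haw
      have := hq.path.adj (L - 1) (by omega)
      rwa [hL', hq.root] at this
    · push Not at hshort
      refine exists_sparse_of_rotation (z := w) (by omega) Finset.subset_union_left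
        (Finset.mem_union_right _ hw) hL ⟨p, hp⟩ (hmax' w hw) (fun q hq v hv hadj => ?_)
        fun g m hg h => hcyc w g m hg fun i hi => (h i hi).imp_left (hnot _)
      rcases Finset.mem_union.1 hv with hv | hv
      · exact Or.inl hv
      · exact Or.inr (hshort q hq v (mem_nbrsIn.2 ⟨hv, hadj⟩))
  · -- Nothing in `R` is attached to the cycle: any vertex of `R` can serve as the root.
    push Not at hatt
    have hnbr : ∀ u ∈ R, nbrsIn G (R ∪ K) u = nbrsIn G R u := fun u hu => by
      rw [nbrsIn_union, hatt u hu, Finset.union_empty]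
    obtain ⟨z, hz⟩ := hR
    obtain ⟨x, hx⟩ : (nbrsIn G R z).Nonempty := Finset.card_pos.1 (by
      have := hdeg z hz
      rw [hnbr z hz] at this
      omega)
    obtain ⟨hxR, hzx⟩ := mem_nbrsIn.1 hx
    have hp1 : IsRootedPath G (R.erase z) z (fun i => if i = 0 then x else z) 1 :=
      ⟨(IsPathSeq.single z).cons hzx.symm fun _ _ => hzx.ne,
        fun i hi => by simpa [Nat.lt_one_iff.1 hi] using ⟨hzx.ne.symm, hxR⟩, by simp⟩
    obtain ⟨⟨p, L⟩, hp, hmax⟩ := exists_maximal_nat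
      (fun x : (ℕ → V) × ℕ => IsRootedPath G (R.erase z) z x.1 x.2) (fun x => x.2)
      (Fintype.card V) (fun x hx => hx.path.length_lt_card.le) ⟨⟨_, 1⟩, hp1⟩
    dsimp only at hp
    have hor : ∀ v ∈ R, v ∈ R.erase z ∨ v = z := fun v hv => by
      by_cases h : v = z
      · exact Or.inr h
      · exact Or.inl (Finset.mem_erase.2 ⟨h, hv⟩)
    obtain ⟨S, hS, hne, hb⟩ := exists_sparse_of_rotation (G := G) (X := R ∪ K) (T := R.erase z)
      (z := z) (k := c / 2) (L := L) (by omega)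
      ((Finset.erase_subset _ _).trans Finset.subset_union_left) (Finset.mem_union_left _ hz)
      (hmax ⟨_, 1⟩ hp1) ⟨p, hp⟩ (fun q M hq => hmax ⟨q, M⟩ hq)
      (fun q hq v hv hadj => by
        have hL : 0 < L := hmax ⟨_, 1⟩ hp1
        have hq0 : q 0 ∈ R := Finset.mem_of_mem_erase (hq.mem 0 hL)
        have : v ∈ nbrsIn G R (q 0) := hnbr (q 0) hq0 ▸ mem_nbrsIn.2 ⟨hv, hadj⟩
        exact hor v (mem_nbrsIn.1 this).1)
      (fun g m hg h => hcyc z g m hg fun i hi =>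
        (h i hi).imp_left fun h => hnot _ (Finset.mem_of_mem_erase h))
    exact ⟨S, hS.trans (Finset.erase_subset _ _), hne, hb⟩

open Classical in
theorem isCyclicEnum_getVert {v : V} {C : G.Walk v v} (hC : C.IsCycle) :
    IsCyclicEnum G C.support.toFinset C.length (fun i => C.getVert (i % C.length)) := by
  have h3 := hC.three_le_length
  refine ⟨fun i => ?_, fun i => by simp, fun i j h => ?_, fun x => ?_⟩
  · have hlt := Nat.mod_lt i (show 0 < C.length by omega)
    have hadj := C.adj_getVert_succ hlt
    rcases Nat.lt_or_ge (i % C.length + 1) C.length with h | h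
    · rwa [Nat.add_mod, Nat.mod_eq_of_lt (show 1 < C.length by omega), Nat.mod_eq_of_lt h]
    · have he : i % C.length + 1 = C.length := by omega
      rw [he, C.getVert_length] at hadj
      rw [Nat.add_mod, Nat.mod_eq_of_lt (show 1 < C.length by omega), he, Nat.mod_self,
        C.getVert_zero]
      exact hadj
  · have hi := Nat.mod_lt i (show 0 < C.length by omega)
    have hj := Nat.mod_lt j (show 0 < C.length by omega)
    exact hC.getVert_injOn' (by simp only [Set.mem_ofPred_eq]; omega)
      (by simp only [Set.mem_ofPred_eq]; omega) h
  · rw [List.mem_toFinset, SimpleGraph.Walk.mem_support_iff_exists_getVert]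
    constructor
    · rintro ⟨i, rfl, hi⟩
      rcases Nat.lt_or_ge i C.length with h | h
      · exact ⟨i, h, by rw [Nat.mod_eq_of_lt h]⟩
      · obtain rfl : i = C.length := by omega
        exact ⟨0, by omega, by simp⟩
    · rintro ⟨i, hi, rfl⟩
      exact ⟨i, by rw [Nat.mod_eq_of_lt hi], hi.le⟩

end LongestCycle

theorem theorem3p2 {V : Type*} [Fintype V] (G : SimpleGraph V) (n c : ℕ)
    (hn : Fintype.card V = n) (v : V) (C : G.Walk v v)
    (hC : LongestCycle.IsLongestCycle G C) (hc : C.length = c)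
    (h4 : 4 ≤ c) (hcn : c ≤ n - 1)
    (hedges : (c / 2 - 1) * (n - c) <
      (LongestCycle.edgesAtMostOneEnd G (LongestCycle.vertexSet C)).ncard) :
    (c = 6 ∨ c = 7 ∨ c = 9) ∨
    (∃ u : V, u ∉ LongestCycle.vertexSet C ∧
      (G.neighborSet u ∩ LongestCycle.vertexSet C).ncard = c / 2) ∨
    (∃ (w : V) (D : G.Walk w w), D.IsCycle ∧
      (LongestCycle.vertexSet C ∩ LongestCycle.vertexSet D).ncard ≤ 1 ∧
      ((LongestCycle.vertexSet C ∩ LongestCycle.vertexSet D).ncard = 0 →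
        2 * (c / 2) - 3 ≤ D.length) ∧
      ((LongestCycle.vertexSet C ∩ LongestCycle.vertexSet D).ncard = 1 →
        2 * (c / 2) - 1 ≤ D.length)) := by
  classical
  subst hc hn
  by_contra hcon
  push Not at hcon
  obtain ⟨⟨h6, h7, h9⟩, hb, hcyc⟩ := hcon
  have hf := LongestCycle.isCyclicEnum_getVert hC.1
  set K := C.support.toFinset with hK
  have hKC : LongestCycle.vertexSet C = (K : Set V) := by
    ext x
    simp [LongestCycle.vertexSet, hK]
  rw [hKC] at hb hcyc hedges
  have hlong : ∀ g m, LongestCycle.IsCycleSeq G g m → m ≤ C.length := by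
    intro g m hg
    obtain ⟨w, D, hD, rfl, -⟩ := hg.exists_walk
    exact hC.2 w D hD
  have hKcard : K.card = C.length := by
    have : K = (Finset.range C.length).image fun i => C.getVert (i % C.length) := by
      ext x
      simp only [hf.mem_iff, Finset.mem_image, Finset.mem_range]
    rw [this, Finset.card_image_of_injOn, Finset.card_range]
    intro i hi j hj h
    simp only [Finset.coe_range, Set.mem_Iio] at hi hj
    have := hf.inj i j h
    rwa [Nat.mod_eq_of_lt hi, Nat.mod_eq_of_lt hj] at this
  have hpairs := LongestCycle.card_pairs_le (G := G) (K := K) (2 * (C.length / 2 - 1))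
    (fun R hRK hR => hf.exists_sparse hlong h4 h6 h7 h9 (fun u hu h => hb u hu ?_)
      (fun z g m hg hgz => ?_) hRK hR) Kᶜ disjoint_compl_left
  · rw [← LongestCycle.two_mul_ncard_edgesAtMostOneEnd, Finset.card_compl, hKcard,
      mul_assoc] at hpairs
    omega
  · rw [← h, ← Set.ncard_coe_finset]
    congr 1
    ext x
    simp [LongestCycle.mem_nbrsIn, and_comm]
  · by_contra! hm
    obtain ⟨w, D, hD, rfl, hsupp⟩ := hg.exists_walk
    have hsub : (K : Set V) ∩ LongestCycle.vertexSet D ⊆ {z} := by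
      rintro x ⟨hxK, hxD⟩
      obtain ⟨i, hi, rfl⟩ := hsupp x hxD
      exact (hgz i hi).resolve_left fun h => h hxK
    have hle := (Set.ncard_le_ncard hsub).trans_eq (Set.ncard_singleton z)
    have := hcyc w D hD hle (fun _ => by omega)
    omega
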